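/- Let $W:\mathbb{R}\to\mathbb{R}$ satisfy: (A) $W$ is continuous and even, $W(0)=0$, and $W\in C^1(\mathbb{R}\setminus\{0\})$; (B) there is $C>0$ with $W(z)\le C(1+|z|^2)$ for all $z\in\mathbb{R}$; (C') there are $\lambda',\lambda''\ge 0$ such that $x\mapsto W(x)+\frac{\lambda''}{2}|x|^2+\lambda'|x|$ is convex. Let $\mathcal{P}_2(\mathbb{R})$ be the set of Borel probability measures on $\mathbb{R}$ with finite second moment, $W_2$ the quadratic Wasserstein distance on it, $\Gamma_0(\mu,\nu)$ the set of transport plans from $\mu$ to $\nu$ that are optimal for the cost $|x-y|^2$, and $$\mathcal{W}[\nu]=\frac12\int_{\mathbb{R}\times\mathbb{R}}W(x-y)\,d\nu(x)\,d\nu(y),\qquad \nu\in\mathcal{P}_2(\mathbb{R}).$$ For $\mu\in\mathcal{P}_2(\mathbb{R})$ the subdifferential $\partial\mathcal{W}[\mu]$ is the set of all $\xi\in L^2(\mu)$ such that, for $\nu\in\mathcal{P}_2(\mathbb{R})$ with $W_2(\mu,\nu)\to0$, $$\mathcal{W}[\nu]-\mathcal{W}[\mu]\ \ge\ \inf_{\gamma\in\Gamma_0(\mu,\nu)}\int_{\mathbb{R}\times\mathbb{R}}\xi(x)\,(y-x)\,d\gamma(x,y)+o\bigl(W_2(\mu,\nu)\bigr).$$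 Suppose that $\mu\in\mathcal{P}_2(\mathbb{R})$ is diffuse, i.e. $\mu(\{x\})=0$ for every $x\in\mathbb{R}$. Then the integrals defining $\mathcal{W}$ on $\mathcal{P}_2(\mathbb{R})$ and $$k(x)=\int_{y\neq x}W'(x-y)\,d\mu(y),\qquad x\in\mathbb{R},$$ converge absolutely, $k$ belongs to $\partial\mathcal{W}[\mu]$, and $k$ is the unique element (up to $\mu$-a.e. equality) of minimal $L^2(\mu)$-norm in $\partial\mathcal{W}[\mu]$. -/

import Mathlib

open MeasureTheory
open scoped ENNReal

noncomputable section

namespace InteractionEnergy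

/-- The assumptions **A**, **B**, **C'** on the interaction potential `W : ℝ → ℝ`. -/
structure IsAdmissible (W : ℝ → ℝ) : Prop where
  continuous : Continuous W
  even : ∀ x, W (-x) = W x
  zero : W 0 = 0
  contDiffOn : ContDiffOn ℝ 1 W {0}ᶜ
  growth : ∃ C : ℝ, 0 < C ∧ ∀ z, W z ≤ C * (1 + |z| ^ 2)
  convex : ∃ l₁ l₂ : ℝ, 0 ≤ l₁ ∧ 0 ≤ l₂ ∧
    ConvexOn ℝ Set.univ (fun x => W x + l₂ / 2 * |x| ^ 2 + l₁ * |x|)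

/-- `μ` belongs to `𝒫₂(ℝ)`: a Borel probability measure with finite second moment. -/
structure IsP2 (μ : Measure ℝ) : Prop where
  isProbabilityMeasure : IsProbabilityMeasure μ
  second_moment : Integrable (fun x : ℝ => x ^ 2) μ

/-- `Γ(μ, ν)`: the transport plans with marginals `μ` and `ν`. -/
def plans (μ ν : Measure ℝ) : Set (Measure (ℝ × ℝ)) :=
  {γ | γ.map Prod.fst = μ ∧ γ.map Prod.snd = ν}

/-- The quadratic transport cost of a plan. -/
def cost (γ : Measure (ℝ × ℝ)) : ℝ≥0∞ :=
  ∫⁻ p, edist p.1 p.2 ^ 2 ∂γ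

/-- The Wasserstein distance `W₂(μ, ν)`; it is finite when `μ, ν ∈ 𝒫₂(ℝ)`. -/
def W2 (μ ν : Measure ℝ) : ℝ :=
  Real.sqrt (⨅ γ ∈ plans μ ν, cost γ).toReal

/-- `Γ₀(μ, ν)`: the plans of minimal quadratic cost. -/
def optimalPlans (μ ν : Measure ℝ) : Set (Measure (ℝ × ℝ)) :=
  {γ | γ ∈ plans μ ν ∧ ∀ γ' ∈ plans μ ν, cost γ ≤ cost γ'}

/-- The Wasserstein (Fréchet) subdifferential `∂φ(μ)`: all `k ∈ L²(μ)` such that, for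
`ν ∈ 𝒫₂(ℝ)`,
`φ(ν) - φ(μ) ≥ inf_{γ ∈ Γ₀(μ, ν)} ∫ k(x) (y - x) dγ(x, y) + o(W₂(μ, ν))`.
The infimum is taken in the extended reals. -/
def subdifferential (φ : Measure ℝ → ℝ) (μ : Measure ℝ) : Set (ℝ → ℝ) :=
  {k | MemLp k 2 μ ∧ ∀ ε : ℝ, 0 < ε → ∃ δ : ℝ, 0 < δ ∧ ∀ ν : Measure ℝ, IsP2 ν → W2 μ ν < δ →
    (⨅ γ ∈ optimalPlans μ ν, ((∫ p, k p.1 * (p.2 - p.1) ∂γ : ℝ) : EReal)) ≤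
      ((φ ν - φ μ + ε * W2 μ ν : ℝ) : EReal)}

/-- The interaction energy `𝒲[μ] = (1/2) ∬ W(x - y) dμ(x) dμ(y)`. -/
def energy (W : ℝ → ℝ) (μ : Measure ℝ) : ℝ :=
  (1 / 2) * ∫ p : ℝ × ℝ, W (p.1 - p.2) ∂(μ.prod μ)

/-- The vector field `k(x) = ∫_{y ≠ x} W'(x - y) dμ(y)`. -/
def field (W : ℝ → ℝ) (μ : Measure ℝ) (x : ℝ) : ℝ :=
  ∫ y in {x}ᶜ, deriv W (x - y) ∂μ

end InteractionEnergy

end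

namespace InteractionEnergy

open Filter Topology Set

/-! ### Estimates on the potential -/

namespace IsAdmissible

variable {W : ℝ → ℝ}

/-! The subdifferential is the single class of `k`, so minimality is automatic.

`k` is a subgradient. On each half-line the kink term `λ'|x|` is affine, so `W` satisfies a tangent
inequality with a quadratic error as long as the two points do not lie on opposite sides of `0`
(`exists_tangent_bound`). For a monotone plan the differences `x - x'` and `y - y'` never have
opposite signs, and `x ≠ x'` almost surely because `μ` is diffuse. Integrating the inequality over
two independent copies of the plan gives a lower bound for the energy with error `O(W₂²)`
(`exists_energy_lower_bound`). The quantile coupling is monotone and monotone plans are optimal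
(`IsMonotonePlan.mem_optimalPlans`), so the infimum over optimal plans is at most the value at this
plan.

Nothing else is a subgradient. A small smooth perturbation `id + t v` is the only optimal transport
onto its image (`ae_eq_of_mem_optimalPlans`), so the infimum for `ξ` equals `t ∫ ξ v dμ`. The energy
along this curve has derivative `∫ k v dμ` at `t = 0` (`hasDerivAt_energy`), again because the
diagonal is null. Since `t` takes both signs, `∫ ξ v = ∫ k v` for every test function `v`. -/

theorem differentiableAt (hW : IsAdmissible W) {x : ℝ} (hx : x ≠ 0) : DifferentiableAt ℝ W x :=
  (hW.contDiffOn.differentiableOn one_ne_zero).differentiableAt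
    (isOpen_compl_singleton.mem_nhds hx)

theorem deriv_neg (hW : IsAdmissible W) (x : ℝ) : deriv W (-x) = -deriv W x := by
  have h := deriv_comp_neg W (-x)
  simp only [hW.even, neg_neg] at h
  exact h

/-- An admissible potential is locally Lipschitz, with constants of linear growth. -/
theorem exists_lipschitz_bound (hW : IsAdmissible W) :
    ∃ A : ℝ, 0 ≤ A ∧ ∀ a b, |W b - W a| ≤ A * (1 + |a| + |b|) * |b - a| := by
  obtain ⟨C, hC, hgrowth⟩ := hW.growth
  obtain ⟨l₁, l₂, hl₁, hl₂, hconv⟩ := hW.convex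
  set V : ℝ → ℝ := fun x => W x + l₂ / 2 * |x| ^ 2 + l₁ * |x| with hV
  have hVeven : ∀ x, V (-x) = V x := fun x => by simp [hV, hW.even]
  have hV0 : ∀ x, 0 ≤ V x := fun x => by
    have h := hconv.2 (mem_univ x) (mem_univ (-x)) (by norm_num : (0 : ℝ) ≤ 1 / 2)
      (by norm_num : (0 : ℝ) ≤ 1 / 2) (by norm_num)
    have h0 : V 0 = 0 := by simp [hV, hW.zero]
    simp only [smul_eq_mul, hVeven] at h
    rw [show 1 / 2 * x + 1 / 2 * -x = 0 by ring, h0] at h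
    linarith
  set B := C + l₂ / 2 + l₁ with hB
  have hB0 : 0 ≤ B := by positivity
  have hVB : ∀ x, V x ≤ B * (1 + |x| ^ 2) := fun x => by
    have h1 := hgrowth x
    have h2 : |x| ≤ 1 + |x| ^ 2 := by nlinarith [sq_nonneg (|x| - 1)]
    have h3 := mul_le_mul_of_nonneg_left h2 hl₁
    simp only [hV, hB]
    nlinarith
  have key : ∀ a b, a < b → V b - V a ≤ 5 * B * (1 + |a| + |b|) * (b - a) := by
    intro a b hab
    set R := 1 + |a| + |b| with hR
    have hR1 : 1 ≤ R := by have := abs_nonneg a; have := abs_nonneg b; linarith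
    -- The slope on `[a, b]` is at most the slope on `[b, b + R]`. A step of length `R` turns the
    -- quadratic growth of `V ≥ 0` into a linear bound on the slope.
    have hs := hconv.slope_mono_adjacent (mem_univ a) (mem_univ (b + R)) hab
      (by linarith : b < b + R)
    rw [div_le_iff₀ (by linarith)] at hs
    refine hs.trans (mul_le_mul_of_nonneg_right ?_ (by linarith))
    rw [add_sub_cancel_left, div_le_iff₀ (by linarith)]
    have h1 : |b + R| ≤ 2 * R := by
      refine (abs_add_le b R).trans ?_
      rw [abs_of_nonneg (by linarith : 0 ≤ R)]
      have := abs_nonneg a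
      linarith
    have h2 : |b + R| ^ 2 ≤ (2 * R) ^ 2 := pow_le_pow_left₀ (abs_nonneg _) h1 2
    calc V (b + R) - V b ≤ B * (1 + |b + R| ^ 2) := by linarith [hVB (b + R), hV0 b]
      _ ≤ B * (5 * R * R) := mul_le_mul_of_nonneg_left (by nlinarith) hB0
      _ = 5 * B * R * R := by ring
  have key' : ∀ a b, a < b → |V b - V a| ≤ 5 * B * (1 + |a| + |b|) * (b - a) := by
    intro a b hab
    refine abs_le.2 ⟨?_, key a b hab⟩
    have h := key (-b) (-a) (by linarith)
    rw [hVeven, hVeven, abs_neg, abs_neg] at h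
    nlinarith
  have keyV : ∀ a b, |V b - V a| ≤ 5 * B * (1 + |a| + |b|) * |b - a| := by
    intro a b
    rcases lt_trichotomy a b with h | h | h
    · rw [abs_of_pos (sub_pos.2 h)]; exact key' a b h
    · simp [h]
    · rw [abs_sub_comm, abs_sub_comm b a, abs_of_pos (sub_pos.2 h), add_right_comm]
      exact key' b a h
  refine ⟨5 * B + l₂ / 2 + l₁, by positivity, fun a b => ?_⟩
  have hW' : W b - W a = (V b - V a) - l₂ / 2 * ((|b| + |a|) * (|b| - |a|)) - l₁ * (|b| - |a|) := by
    simp only [hV]; ring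
  have h1 : |(|b| - |a|)| ≤ |b - a| := abs_abs_sub_abs_le b a
  have ha := abs_nonneg a
  have hb := abs_nonneg b
  have hba := abs_nonneg (b - a)
  have h2 : |l₂ / 2 * ((|b| + |a|) * (|b| - |a|))| ≤ l₂ / 2 * (1 + |a| + |b|) * |b - a| := by
    rw [abs_mul, abs_mul, abs_of_nonneg (by positivity : 0 ≤ l₂ / 2),
      abs_of_nonneg (by positivity : 0 ≤ |b| + |a|), mul_assoc]
    exact mul_le_mul_of_nonneg_left
      (mul_le_mul (by linarith) h1 (abs_nonneg _) (by positivity)) (by positivity)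
  have h3 : |l₁ * (|b| - |a|)| ≤ l₁ * (1 + |a| + |b|) * |b - a| := by
    rw [abs_mul, abs_of_nonneg hl₁]
    refine (mul_le_mul_of_nonneg_left h1 hl₁).trans
      (mul_le_mul_of_nonneg_right (le_mul_of_one_le_right hl₁ (by linarith)) hba)
  rw [hW']
  refine (abs_sub _ _).trans ((add_le_add (abs_sub _ _) le_rfl).trans ?_)
  linarith [keyV a b]

theorem exists_deriv_bound (hW : IsAdmissible W) :
    ∃ A : ℝ, 0 ≤ A ∧ ∀ x, |deriv W x| ≤ A * (1 + |x|) := by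
  obtain ⟨A, hA, h⟩ := hW.exists_lipschitz_bound
  refine ⟨2 * A, by positivity, fun x => ?_⟩
  rw [← Real.norm_eq_abs]
  refine norm_deriv_le_of_lip' (by positivity) ?_
  filter_upwards [Metric.ball_mem_nhds x one_pos] with y hy
  rw [Metric.mem_ball, Real.dist_eq] at hy
  rw [Real.norm_eq_abs, Real.norm_eq_abs]
  refine (h x y).trans (mul_le_mul_of_nonneg_right ?_ (abs_nonneg _))
  have : |y| ≤ |x| + 1 := by linarith [abs_sub_abs_le_abs_sub y x]
  nlinarith

/-- The tangent line inequality, up to a quadratic term, between points on the same side of `0`. -/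
theorem exists_tangent_bound (hW : IsAdmissible W) :
    ∃ l : ℝ, 0 ≤ l ∧ ∀ a b, a ≠ 0 → 0 ≤ a * b →
      deriv W a * (b - a) - l / 2 * (b - a) ^ 2 ≤ W b - W a := by
  obtain ⟨l₁, l₂, hl₁, hl₂, hconv⟩ := hW.convex
  refine ⟨l₂, hl₂, ?_⟩
  have key : ∀ a b, 0 < a → 0 ≤ b →
      deriv W a * (b - a) - l₂ / 2 * (b - a) ^ 2 ≤ W b - W a := by
    intro a b ha hb
    -- Without the absolute values, the `l₁` term is linear and cancels from the tangent inequality;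
    -- the `l₂` term leaves exactly the quadratic error.
    have hU : ConvexOn ℝ (Ici (0 : ℝ)) (fun x => W x + l₂ / 2 * x ^ 2 + l₁ * x) := by
      refine (hconv.subset (subset_univ _) (convex_Ici 0)).congr fun x hx => ?_
      simp only [abs_of_nonneg (mem_Ici.1 hx)]
    have hd : HasDerivAt (fun x => W x + l₂ / 2 * x ^ 2 + l₁ * x)
        (deriv W a + l₂ * a + l₁) a := by
      have h1 := (hW.differentiableAt ha.ne').hasDerivAt
      have h2 := ((hasDerivAt_pow 2 a).const_mul (l₂ / 2))
      have h3 := (hasDerivAt_id a).const_mul l₁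
      convert! (h1.add h2).add h3 using 1
      simp; ring
    rcases lt_trichotomy a b with h | h | h
    · have := hU.le_slope_of_hasDerivAt (mem_Ici.2 ha.le) (mem_Ici.2 hb) h hd
      rw [slope_def_field, le_div_iff₀ (sub_pos.2 h)] at this
      linarith
    · simp [h]
    · have := hU.slope_le_of_hasDerivAt (mem_Ici.2 hb) (mem_Ici.2 ha.le) h hd
      rw [slope_def_field, div_le_iff₀ (sub_pos.2 h)] at this
      linarith
  intro a b ha hab
  rcases ha.lt_or_gt with h | h
  · have := key (-a) (-b) (by linarith) (by nlinarith)
    rw [hW.deriv_neg, hW.even, hW.even] at this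
    linarith
  · exact key a b h (by nlinarith)

end IsAdmissible

/-- `γ` charges only pairs of points that are ordered in the same way in both coordinates. -/
def IsMonotonePlan (γ : Measure (ℝ × ℝ)) : Prop :=
  ∀ᵐ z ∂γ.prod γ, 0 ≤ (z.1.1 - z.2.1) * (z.1.2 - z.2.2)

/-! ### Optimality of monotone plans -/

/-- If `Q ⊆ P` up to a null set, then `γ (P \ Q)` is the difference of the two prescribed masses,
the least value possible. -/
theorem measure_diff_le_of_diff_eq_zero {α : Type*} [MeasurableSpace α] {γ γ' : Measure α}
    [IsFiniteMeasure γ] {P Q : Set α} (hP : MeasurableSet P) (hQ : MeasurableSet Q)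
    (hPe : γ P = γ' P) (hQe : γ Q = γ' Q) (h : γ (P \ Q) = 0 ∨ γ (Q \ P) = 0) :
    γ (P \ Q) ≤ γ' (P \ Q) := by
  rcases h with h | h
  · simp [h]
  · have h1 : γ (P ∩ Q) = γ Q := by
      rw [← measure_inter_add_sdiff Q hP, h, add_zero, inter_comm]
    have h2 : γ Q + γ (P \ Q) ≤ γ Q + γ' (P \ Q) := by
      rw [← h1, measure_inter_add_sdiff P hQ, hPe, h1, hQe, ← measure_inter_add_sdiff P hQ]
      gcongr
      exact inter_subset_right
    exact (ENNReal.add_le_add_iff_left (measure_ne_top γ Q)).1 h2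

/-- `|x - y|²` is the area of the square of points with both coordinates between `x` and `y`;
Tonelli then writes the cost through masses of quadrants, which can be compared one at a time. -/
theorem cost_eq_lintegral (γ : Measure (ℝ × ℝ)) [SFinite γ] :
    cost γ = (∫⁻ z : ℝ × ℝ, γ ({p | p.1 ≤ min z.1 z.2} \ {p | p.2 ≤ max z.1 z.2})) +
      ∫⁻ z : ℝ × ℝ, γ ({p | p.2 ≤ min z.1 z.2} \ {p | p.1 ≤ max z.1 z.2}) := by
  have hE₁ : MeasurableSet {w : (ℝ × ℝ) × (ℝ × ℝ) | w.1.1 ≤ min w.2.1 w.2.2 ∧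
      max w.2.1 w.2.2 < w.1.2} := by
    rw [ofPred_and]
    exact (measurableSet_le (by fun_prop) (by fun_prop)).inter
      (measurableSet_lt (by fun_prop) (by fun_prop))
  have hE₂ : MeasurableSet {w : (ℝ × ℝ) × (ℝ × ℝ) | w.1.2 ≤ min w.2.1 w.2.2 ∧
      max w.2.1 w.2.2 < w.1.1} := by
    rw [ofPred_and]
    exact (measurableSet_le (by fun_prop) (by fun_prop)).inter
      (measurableSet_lt (by fun_prop) (by fun_prop))
  have h₁ := (Measure.prod_apply (μ := γ) (ν := (volume : Measure (ℝ × ℝ))) hE₁).symm.trans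
    (Measure.prod_apply_symm hE₁)
  have h₂ := (Measure.prod_apply (μ := γ) (ν := (volume : Measure (ℝ × ℝ))) hE₂).symm.trans
    (Measure.prod_apply_symm hE₂)
  have hbox : ∀ a b : ℝ, volume {z : ℝ × ℝ | a ≤ min z.1 z.2 ∧ max z.1 z.2 < b} =
      ENNReal.ofReal (b - a) ^ 2 := by
    intro a b
    have : {z : ℝ × ℝ | a ≤ min z.1 z.2 ∧ max z.1 z.2 < b} = Ico a b ×ˢ Ico a b := by
      ext z
      simp only [mem_ofPred_eq, le_min_iff, max_lt_iff, mem_prod, mem_Ico]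
      tauto
    rw [this, Measure.volume_eq_prod, Measure.prod_prod, Real.volume_Ico, sq]
  have hset : ∀ (X Y : ℝ × ℝ → ℝ) (z : ℝ × ℝ),
      {p | X p ≤ min z.1 z.2} \ {p | Y p ≤ max z.1 z.2} =
        {p | X p ≤ min z.1 z.2 ∧ max z.1 z.2 < Y p} := by
    intro X Y z; ext p; simp [not_le]
  simp only [preimage_ofPred_eq] at h₁ h₂
  simp only [hset, ← h₁, ← h₂, hbox]
  rw [← lintegral_add_left (by fun_prop)]
  refine lintegral_congr fun p => ?_
  rw [edist_dist, Real.dist_eq]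
  rcases le_total p.1 p.2 with h | h
  · rw [abs_of_nonpos (by linarith), neg_sub, ENNReal.ofReal_of_nonpos (sub_nonpos.2 h)]
    simp
  · rw [abs_of_nonneg (by linarith), ENNReal.ofReal_of_nonpos (sub_nonpos.2 h)]
    simp

theorem isProbabilityMeasure_of_mem_plans {μ ν : Measure ℝ} [IsProbabilityMeasure μ]
    {γ : Measure (ℝ × ℝ)} (hγ : γ ∈ plans μ ν) : IsProbabilityMeasure γ := by
  have : IsProbabilityMeasure (γ.map Prod.fst) := by rw [hγ.1]; infer_instance
  exact Measure.isProbabilityMeasure_of_map Prod.fst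

/-- A point of the first set and a point of the second are ordered oppositely in the two
coordinates, so the product of the two sets is null. -/
theorem IsMonotonePlan.measure_diff_eq_zero {γ : Measure (ℝ × ℝ)} [SFinite γ]
    (hmono : IsMonotonePlan γ) (s t : ℝ) :
    γ ({p | p.1 ≤ s} \ {p | p.2 ≤ t}) = 0 ∨ γ ({p | p.2 ≤ t} \ {p | p.1 ≤ s}) = 0 := by
  rw [← mul_eq_zero, ← Measure.prod_prod]
  refine measure_mono_null (fun z hz => ?_) hmono
  simp only [mem_prod, Set.mem_sdiff, mem_ofPred_eq, not_le] at hz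
  simp only [mem_compl_iff, mem_ofPred_eq, not_le]
  exact mul_neg_of_neg_of_pos (by linarith) (by linarith)

theorem IsMonotonePlan.mem_optimalPlans {μ ν : Measure ℝ} [IsProbabilityMeasure μ]
    {γ : Measure (ℝ × ℝ)} (hγ : γ ∈ plans μ ν) (hmono : IsMonotonePlan γ) :
    γ ∈ optimalPlans μ ν := by
  refine ⟨hγ, fun γ' hγ' => ?_⟩
  have := isProbabilityMeasure_of_mem_plans hγ
  have := isProbabilityMeasure_of_mem_plans hγ'
  have hfst : ∀ s : ℝ, γ {p | p.1 ≤ s} = γ' {p | p.1 ≤ s} := fun s => by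
    have h := congrArg (fun m => m (Iic s)) (hγ.1.trans hγ'.1.symm)
    rwa [Measure.map_apply measurable_fst measurableSet_Iic,
      Measure.map_apply measurable_fst measurableSet_Iic] at h
  have hsnd : ∀ s : ℝ, γ {p | p.2 ≤ s} = γ' {p | p.2 ≤ s} := fun s => by
    have h := congrArg (fun m => m (Iic s)) (hγ.2.trans hγ'.2.symm)
    rwa [Measure.map_apply measurable_snd measurableSet_Iic,
      Measure.map_apply measurable_snd measurableSet_Iic] at h
  have hm1 : ∀ s : ℝ, MeasurableSet {p : ℝ × ℝ | p.1 ≤ s} := fun s =>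
    measurableSet_le measurable_fst measurable_const
  have hm2 : ∀ s : ℝ, MeasurableSet {p : ℝ × ℝ | p.2 ≤ s} := fun s =>
    measurableSet_le measurable_snd measurable_const
  rw [cost_eq_lintegral, cost_eq_lintegral]
  refine add_le_add (lintegral_mono fun z => ?_) (lintegral_mono fun z => ?_)
  · exact measure_diff_le_of_diff_eq_zero (hm1 _) (hm2 _) (hfst _) (hsnd _)
      (hmono.measure_diff_eq_zero _ _)
  · exact measure_diff_le_of_diff_eq_zero (hm2 _) (hm1 _) (hsnd _) (hfst _)
      (hmono.measure_diff_eq_zero _ _).symm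

/-! ### The quantile coupling -/

/-- The quantile function of a probability measure, extended by `0` outside `(0, 1)`. -/
noncomputable def quantile (μ : Measure ℝ) : ℝ → ℝ :=
  (Ioo (0 : ℝ) 1).indicator fun u => sInf {x | u ≤ ProbabilityTheory.cdf μ x}

/-- Right continuity of the distribution function makes the infimum attained. Monotonicity,
measurability and the law of the quantile function all follow from this equivalence. -/
theorem quantile_le_iff (μ : Measure ℝ) {u : ℝ} (hu : u ∈ Ioo (0 : ℝ) 1) (x : ℝ) :
    quantile μ u ≤ x ↔ u ≤ ProbabilityTheory.cdf μ x := by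
  rw [quantile, indicator_of_mem hu]
  have hne : {x | u ≤ ProbabilityTheory.cdf μ x}.Nonempty :=
    (((ProbabilityTheory.tendsto_cdf_atTop μ).eventually (lt_mem_nhds hu.2)).exists).imp
      fun _ h => h.le
  have hbdd : BddBelow {x | u ≤ ProbabilityTheory.cdf μ x} := by
    obtain ⟨y, hy⟩ := ((ProbabilityTheory.tendsto_cdf_atBot μ).eventually
      (gt_mem_nhds hu.1)).exists
    refine ⟨y, fun z hz => le_of_not_gt fun hzy => ?_⟩
    exact absurd (hz.trans (ProbabilityTheory.monotone_cdf μ hzy.le)) (not_le.2 hy)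
  refine ⟨fun h => ?_, fun h => csInf_le hbdd h⟩
  have hcont : Tendsto (ProbabilityTheory.cdf μ) (𝓝[>] x) (𝓝 (ProbabilityTheory.cdf μ x)) :=
    ((ProbabilityTheory.cdf μ).right_continuous x).mono Ioi_subset_Ici_self
  refine ge_of_tendsto hcont ?_
  filter_upwards [self_mem_nhdsWithin] with y hy
  obtain ⟨z, hz, hzy⟩ := (csInf_lt_iff hbdd hne).1 (h.trans_lt hy)
  exact le_trans hz (ProbabilityTheory.monotone_cdf μ hzy.le)

theorem quantile_monotoneOn (μ : Measure ℝ) : MonotoneOn (quantile μ) (Ioo 0 1) := by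
  intro u hu v hv huv
  rw [quantile_le_iff μ hu]
  exact huv.trans ((quantile_le_iff μ hv _).1 le_rfl)

theorem measurable_quantile (μ : Measure ℝ) : Measurable (quantile μ) := by
  refine measurable_of_Iic fun x => ?_
  -- The default value `0` puts the complement of `(0, 1)` into the preimage exactly when `0 ≤ x`.
  by_cases hx : 0 ≤ x
  · have : quantile μ ⁻¹' Iic x = (Ioo 0 1 ∩ Iic (ProbabilityTheory.cdf μ x)) ∪ (Ioo 0 1)ᶜ := by
      ext u
      by_cases hu : u ∈ Ioo (0 : ℝ) 1
      · simp only [mem_preimage, mem_Iic, quantile_le_iff μ hu, mem_union, mem_inter_iff, hu,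
          mem_compl_iff, true_and, not_true, or_false]
      · simp [quantile, hu, hx]
    rw [this]
    exact (measurableSet_Ioo.inter measurableSet_Iic).union measurableSet_Ioo.compl
  · have : quantile μ ⁻¹' Iic x = Ioo 0 1 ∩ Iic (ProbabilityTheory.cdf μ x) := by
      ext u
      by_cases hu : u ∈ Ioo (0 : ℝ) 1
      · simp only [mem_preimage, mem_Iic, quantile_le_iff μ hu, mem_inter_iff, hu, true_and]
      · simp [quantile, hu, hx]
    rw [this]
    exact measurableSet_Ioo.inter measurableSet_Iic

theorem map_quantile (μ : Measure ℝ) [IsProbabilityMeasure μ] :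
    (volume.restrict (Ioo (0 : ℝ) 1)).map (quantile μ) = μ := by
  have hP : IsFiniteMeasure ((volume.restrict (Ioo (0 : ℝ) 1)).map (quantile μ)) := inferInstance
  refine Measure.ext_of_Iic _ _ fun x => ?_
  have h1 : (volume.restrict (Ioo (0 : ℝ) 1)) (quantile μ ⁻¹' Iic x) =
      (volume.restrict (Ioo (0 : ℝ) 1)) (Iic (ProbabilityTheory.cdf μ x)) := by
    refine measure_congr ?_
    filter_upwards [ae_restrict_mem measurableSet_Ioo] with u hu
    exact propext (quantile_le_iff μ hu x)
  rw [Measure.map_apply (measurable_quantile μ) measurableSet_Iic, h1,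
    Measure.restrict_congr_set Ioo_ae_eq_Ioc, Measure.restrict_apply measurableSet_Iic, inter_comm,
    Ioc_inter_Iic, min_eq_right (ProbabilityTheory.cdf_le_one μ x), Real.volume_Ioc, sub_zero,
    ProbabilityTheory.ofReal_cdf]

theorem exists_isMonotonePlan (μ ν : Measure ℝ) [IsProbabilityMeasure μ]
    [IsProbabilityMeasure ν] : ∃ γ ∈ plans μ ν, IsMonotonePlan γ := by
  have hf : Measurable fun u => (quantile μ u, quantile ν u) :=
    (measurable_quantile μ).prodMk (measurable_quantile ν)
  refine ⟨(volume.restrict (Ioo (0 : ℝ) 1)).map fun u => (quantile μ u, quantile ν u),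
    ⟨?_, ?_⟩, ?_⟩
  · rw [Measure.map_map measurable_fst hf]
    exact map_quantile μ
  · rw [Measure.map_map measurable_snd hf]
    exact map_quantile ν
  · rw [IsMonotonePlan, Measure.map_prod_map _ _ hf hf,
      ae_map_iff (hf.prodMap hf).aemeasurable
        (measurableSet_le measurable_const (by fun_prop)), Measure.prod_restrict]
    filter_upwards [ae_restrict_mem (measurableSet_Ioo.prod measurableSet_Ioo)] with z hz
    simp only [Prod.map_fst, Prod.map_snd]
    rcases le_total z.1 z.2 with h | h
    · exact mul_nonneg_of_nonpos_of_nonpos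
        (sub_nonpos.2 (quantile_monotoneOn μ hz.1 hz.2 h))
        (sub_nonpos.2 (quantile_monotoneOn ν hz.1 hz.2 h))
    · exact mul_nonneg (sub_nonneg.2 (quantile_monotoneOn μ hz.2 hz.1 h))
        (sub_nonneg.2 (quantile_monotoneOn ν hz.2 hz.1 h))

/-! ### Integrability and the field -/

section Integrability

variable {Ω : Type*} [MeasurableSpace Ω] {P : Measure Ω} {W : ℝ → ℝ} {μ : Measure ℝ}
  {f g : Ω → ℝ}

theorem IsP2.memLp (hμ : IsP2 μ) : MemLp (fun x : ℝ => x) 2 μ :=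
  (memLp_two_iff_integrable_sq measurable_id.aestronglyMeasurable).2 hμ.second_moment

theorem IsP2.memLp_of_map (hμ : IsP2 μ) (hf : Measurable f) (hmap : P.map f = μ) :
    MemLp f 2 P := by
  have h := hμ.memLp
  rw [← hmap] at h
  exact (memLp_map_measure_iff measurable_id.aestronglyMeasurable hf.aemeasurable).1 h

theorem isP2_map [IsProbabilityMeasure P] (hf : Measurable f) (hf2 : MemLp f 2 P) :
    IsP2 (P.map f) := by
  refine ⟨Measure.isProbabilityMeasure_map hf.aemeasurable, ?_⟩
  rw [integrable_map_measure (by fun_prop) hf.aemeasurable]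
  exact hf2.integrable_sq

theorem IsAdmissible.integrable_comp [IsFiniteMeasure P] (hW : IsAdmissible W)
    (hf : MemLp f 2 P) : Integrable (fun ω => W (f ω)) P := by
  obtain ⟨A, hA, h⟩ := hW.exists_lipschitz_bound
  have hb : Integrable (fun ω => A * (1 + 2 * f ω ^ 2)) P :=
    ((integrable_const 1).add (hf.integrable_sq.const_mul 2)).const_mul A
  refine hb.mono' (hW.continuous.comp_aestronglyMeasurable hf.1) (ae_of_all _ fun ω => ?_)
  have h0 := h 0 (f ω)
  simp only [hW.zero, sub_zero, abs_zero, add_zero] at h0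
  rw [Real.norm_eq_abs]
  refine h0.trans ?_
  rw [mul_assoc]
  refine mul_le_mul_of_nonneg_left ?_ hA
  nlinarith [sq_nonneg (|f ω| - 1), sq_abs (f ω)]

theorem IsAdmissible.memLp_deriv_comp [IsFiniteMeasure P] (hW : IsAdmissible W)
    (hf : MemLp f 2 P) : MemLp (fun ω => deriv W (f ω)) 2 P := by
  obtain ⟨A, hA, h⟩ := hW.exists_deriv_bound
  have hb : MemLp (fun ω => A * (1 + |f ω|)) 2 P :=
    MemLp.const_mul (f := fun ω => 1 + |f ω|) (MemLp.add (memLp_const (1 : ℝ)) hf.abs) A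
  refine hb.of_le ((measurable_deriv W).comp_aemeasurable hf.1.aemeasurable).aestronglyMeasurable
    (ae_of_all _ fun ω => ?_)
  rw [Real.norm_eq_abs, Real.norm_eq_abs]
  exact (h (f ω)).trans (le_abs_self _)

theorem memLp_sub_prod [IsFiniteMeasure P] (hf : MemLp f 2 P) :
    MemLp (fun z : Ω × Ω => f z.1 - f z.2) 2 (P.prod P) :=
  (hf.comp_fst P).sub (hf.comp_snd P)

theorem field_eq (hdiff : ∀ x : ℝ, μ {x} = 0) (x : ℝ) :
    field W μ x = ∫ y, deriv W (x - y) ∂μ := by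
  rw [field, Measure.restrict_eq_self_of_ae_mem]
  rw [ae_iff]
  simpa using hdiff x

theorem IsAdmissible.integrable_deriv_sub (hW : IsAdmissible W) (hμ : IsP2 μ) (x : ℝ) :
    Integrable (fun y => deriv W (x - y)) μ := by
  have := hμ.isProbabilityMeasure
  exact (hW.memLp_deriv_comp ((memLp_const x).sub hμ.memLp)).integrable (by norm_num)

theorem measurable_field (hμ : IsP2 μ) (hdiff : ∀ x : ℝ, μ {x} = 0) :
    Measurable (field W μ) := by
  have := hμ.isProbabilityMeasure
  have h : StronglyMeasurable fun x => ∫ y, deriv W (x - y) ∂μ := by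
    refine StronglyMeasurable.integral_prod_right (f := fun x y => deriv W (x - y)) ?_
    exact ((measurable_deriv W).comp (measurable_fst.sub measurable_snd)).stronglyMeasurable
  have he : field W μ = fun x => ∫ y, deriv W (x - y) ∂μ := funext (field_eq hdiff)
  rw [he]
  exact h.measurable

theorem IsAdmissible.memLp_field (hW : IsAdmissible W) (hμ : IsP2 μ)
    (hdiff : ∀ x : ℝ, μ {x} = 0) : MemLp (field W μ) 2 μ := by
  have := hμ.isProbabilityMeasure
  obtain ⟨A, hA, h⟩ := hW.exists_deriv_bound
  have hint : Integrable (fun y : ℝ => |y|) μ := hμ.memLp.abs.integrable (by norm_num)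
  have hb : MemLp (fun x : ℝ => A * (1 + |x| + ∫ y, |y| ∂μ)) 2 μ :=
    MemLp.const_mul (f := fun x : ℝ => 1 + |x| + ∫ y, |y| ∂μ)
      (MemLp.add (MemLp.add (memLp_const (1 : ℝ)) hμ.memLp.abs) (memLp_const _)) A
  refine hb.of_le (measurable_field hμ hdiff).aestronglyMeasurable (ae_of_all _ fun x => ?_)
  rw [field_eq hdiff, Real.norm_eq_abs (A * _)]
  refine (norm_integral_le_integral_norm _).trans (le_trans ?_ (le_abs_self _))
  have hx : Integrable (fun y : ℝ => A * (1 + |x| + |y|)) μ :=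
    ((integrable_const _).add hint).const_mul A
  refine (integral_mono (hW.integrable_deriv_sub hμ x).norm hx fun y => ?_).trans ?_
  · refine (h (x - y)).trans (mul_le_mul_of_nonneg_left ?_ hA)
    linarith [abs_sub x y]
  · rw [integral_const_mul, integral_add (integrable_const _) hint]
    simp

theorem ae_prod_ne [SFinite P] (hf : Measurable f) (hmap : P.map f = μ)
    (hdiff : ∀ x : ℝ, μ {x} = 0) : ∀ᵐ z ∂P.prod P, f z.1 ≠ f z.2 := by
  have hm : MeasurableSet {z : Ω × Ω | ¬ f z.1 ≠ f z.2} := by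
    simp only [ne_eq, not_not]
    exact measurableSet_eq_fun (hf.comp measurable_fst) (hf.comp measurable_snd)
  rw [ae_iff, Measure.measure_prod_null hm]
  refine ae_of_all _ fun ω => ?_
  have h := hdiff (f ω)
  rw [← hmap, Measure.map_apply hf (measurableSet_singleton _)] at h
  refine measure_mono_null (fun ω' hω' => ?_) h
  simpa [eq_comm] using hω'

theorem energy_map [SFinite P] (hW : IsAdmissible W) (hf : Measurable f) :
    energy W (P.map f) = 1 / 2 * ∫ z : Ω × Ω, W (f z.1 - f z.2) ∂P.prod P := by
  rw [energy, Measure.map_prod_map _ _ hf hf, integral_map (hf.prodMap hf).aemeasurable]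
  · rfl
  · exact (hW.continuous.comp (continuous_fst.sub continuous_snd)).aestronglyMeasurable

/-- `W'` is odd, so exchanging the two copies shows that both terms contribute equally. The
resulting factor `2` cancels the `1 / 2` in the energy. -/
theorem IsAdmissible.integral_deriv_mul_sub [IsFiniteMeasure P] (hW : IsAdmissible W)
    (hμ : IsP2 μ) (hdiff : ∀ x : ℝ, μ {x} = 0) (hf : Measurable f) (hmap : P.map f = μ)
    (hg : MemLp g 2 P) :
    ∫ z : Ω × Ω, deriv W (f z.1 - f z.2) * (g z.1 - g z.2) ∂P.prod P =
      2 * ∫ ω, field W μ (f ω) * g ω ∂P := by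
  have hd := hW.memLp_deriv_comp (memLp_sub_prod (hμ.memLp_of_map hf hmap))
  have h1 : Integrable (fun z : Ω × Ω => deriv W (f z.1 - f z.2) * g z.1) (P.prod P) :=
    hd.integrable_mul (hg.comp_fst P)
  have h2 : Integrable (fun z : Ω × Ω => deriv W (f z.1 - f z.2) * g z.2) (P.prod P) :=
    hd.integrable_mul (hg.comp_snd P)
  have hswap : ∫ z : Ω × Ω, deriv W (f z.1 - f z.2) * g z.2 ∂P.prod P =
      -∫ z : Ω × Ω, deriv W (f z.1 - f z.2) * g z.1 ∂P.prod P := by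
    rw [← integral_prod_swap, ← integral_neg]
    refine integral_congr_ae (ae_of_all _ fun z => ?_)
    simp only [Prod.fst_swap, Prod.snd_swap]
    rw [← neg_sub (f z.1), hW.deriv_neg]
    ring
  have hmain : ∫ z : Ω × Ω, deriv W (f z.1 - f z.2) * g z.1 ∂P.prod P =
      ∫ ω, field W μ (f ω) * g ω ∂P := by
    rw [integral_prod _ h1]
    refine integral_congr_ae (ae_of_all _ fun ω => ?_)
    simp only
    rw [integral_mul_const, field_eq hdiff, ← hmap, integral_map hf.aemeasurable]
    exact ((measurable_deriv W).comp (by fun_prop)).aestronglyMeasurable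
  simp only [mul_sub]
  rw [integral_sub h1 h2, hswap, hmain]
  ring

end Integrability

/-! ### The field is a subgradient -/

section Subgradient

variable {W : ℝ → ℝ} {μ ν : Measure ℝ} {γ : Measure (ℝ × ℝ)}

theorem memLp_displacement (hμ : IsP2 μ) (hν : IsP2 ν) (hγ : γ ∈ plans μ ν) :
    MemLp (fun p : ℝ × ℝ => p.2 - p.1) 2 γ :=
  (hν.memLp_of_map measurable_snd hγ.2).sub (hμ.memLp_of_map measurable_fst hγ.1)

theorem cost_eq_ofReal (h : MemLp (fun p : ℝ × ℝ => p.2 - p.1) 2 γ) :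
    cost γ = ENNReal.ofReal (∫ p, (p.2 - p.1) ^ 2 ∂γ) := by
  rw [ofReal_integral_eq_lintegral_ofReal h.integrable_sq (ae_of_all _ fun p => sq_nonneg _),
    cost]
  refine lintegral_congr fun p => ?_
  rw [edist_comm, edist_dist, Real.dist_eq, ← ENNReal.ofReal_pow (abs_nonneg _), sq_abs]

theorem W2_sq_of_mem_optimalPlans (hμ : IsP2 μ) (hν : IsP2 ν) (hγ : γ ∈ optimalPlans μ ν) :
    W2 μ ν ^ 2 = ∫ p, (p.2 - p.1) ^ 2 ∂γ := by
  have hinf : ⨅ γ' ∈ plans μ ν, cost γ' = cost γ :=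
    le_antisymm (iInf₂_le γ hγ.1) (le_iInf₂ hγ.2)
  rw [W2, Real.sq_sqrt ENNReal.toReal_nonneg, hinf,
    cost_eq_ofReal (memLp_displacement hμ hν hγ.1),
    ENNReal.toReal_ofReal (integral_nonneg fun p => sq_nonneg _)]

/-- The tangent inequality integrated over `γ.prod γ`. The error constant is `1/2 · l/2 · 4 = l`,
where `4` comes from `(d - d')² ≤ 2d² + 2d'²`. -/
theorem IsAdmissible.exists_energy_lower_bound (hW : IsAdmissible W) (hμ : IsP2 μ)
    (hdiff : ∀ x : ℝ, μ {x} = 0) : ∃ l : ℝ, 0 ≤ l ∧ ∀ ν γ, IsP2 ν → γ ∈ plans μ ν →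
      IsMonotonePlan γ → (∫ p, field W μ p.1 * (p.2 - p.1) ∂γ) - l * ∫ p, (p.2 - p.1) ^ 2 ∂γ ≤
        energy W ν - energy W μ := by
  obtain ⟨l, hl, htan⟩ := hW.exists_tangent_bound
  refine ⟨l, hl, fun ν γ hν hγ hmono => ?_⟩
  have := hμ.isProbabilityMeasure
  have := isProbabilityMeasure_of_mem_plans hγ
  have hd := memLp_displacement hμ hν hγ
  set d : ℝ × ℝ → ℝ := fun p => p.2 - p.1 with hddef
  have hx := memLp_sub_prod (hμ.memLp_of_map measurable_fst hγ.1)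
  have hy := memLp_sub_prod (hν.memLp_of_map measurable_snd hγ.2)
  have hEμ := energy_map (P := γ) hW measurable_fst
  have hEν := energy_map (P := γ) hW measurable_snd
  rw [hγ.1] at hEμ
  rw [hγ.2] at hEν
  have hdd := memLp_sub_prod hd
  have hi1 : Integrable (fun z : (ℝ × ℝ) × (ℝ × ℝ) =>
      deriv W (z.1.1 - z.2.1) * (d z.1 - d z.2)) (γ.prod γ) :=
    (hW.memLp_deriv_comp hx).integrable_mul hdd
  have hi2 : Integrable (fun z : (ℝ × ℝ) × (ℝ × ℝ) =>
      l / 2 * (d z.1 - d z.2) ^ 2) (γ.prod γ) := hdd.integrable_sq.const_mul _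
  have hmonoint := integral_mono_ae (hi1.sub hi2)
    ((hW.integrable_comp hy).sub (hW.integrable_comp hx)) (by
      filter_upwards [hmono, ae_prod_ne measurable_fst hγ.1 hdiff] with z hz hne
      have := htan (z.1.1 - z.2.1) (z.1.2 - z.2.2) (sub_ne_zero.2 hne) hz
      have he : d z.1 - d z.2 = z.1.2 - z.2.2 - (z.1.1 - z.2.1) := by simp only [hddef]; ring
      simp only [Pi.sub_apply, he]
      exact this)
  simp only [Pi.sub_apply] at hmonoint
  rw [integral_sub hi1 hi2, integral_sub (hW.integrable_comp hy) (hW.integrable_comp hx),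
    hW.integral_deriv_mul_sub hμ hdiff measurable_fst hγ.1 hd, integral_const_mul] at hmonoint
  have hsq : ∫ z, (d z.1 - d z.2) ^ 2 ∂γ.prod γ ≤ 4 * ∫ p, d p ^ 2 ∂γ := by
    have hs1 : Integrable (fun z : (ℝ × ℝ) × (ℝ × ℝ) => 2 * d z.1 ^ 2) (γ.prod γ) :=
      ((hd.comp_fst γ).integrable_sq).const_mul 2
    have hs2 : Integrable (fun z : (ℝ × ℝ) × (ℝ × ℝ) => 2 * d z.2 ^ 2) (γ.prod γ) :=
      ((hd.comp_snd γ).integrable_sq).const_mul 2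
    refine (integral_mono hdd.integrable_sq (hs1.add hs2) fun z => ?_).trans ?_
    · simp only [Pi.add_apply]
      nlinarith [sq_nonneg (d z.1 + d z.2)]
    · simp only [Pi.add_apply]
      rw [integral_add hs1 hs2, integral_fun_fst (fun p => 2 * d p ^ 2),
        integral_fun_snd (fun p => 2 * d p ^ 2), integral_const_mul]
      simp only [probReal_univ, one_smul]
      linarith
  have hl2 := mul_le_mul_of_nonneg_left hsq (by positivity : 0 ≤ l / 2)
  rw [hEμ, hEν]
  simp only [hddef] at hmonoint hl2 ⊢
  linarith

theorem IsAdmissible.field_mem_subdifferential (hW : IsAdmissible W) (hμ : IsP2 μ)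
    (hdiff : ∀ x : ℝ, μ {x} = 0) : field W μ ∈ subdifferential (energy W) μ := by
  refine ⟨hW.memLp_field hμ hdiff, fun ε hε => ?_⟩
  obtain ⟨l, hl, hlow⟩ := hW.exists_energy_lower_bound hμ hdiff
  -- Chosen so that `l * W₂² ≤ ε * W₂`; the `+ 1` covers `l = 0`.
  refine ⟨ε / (l + 1), by positivity, fun ν hν hδ => ?_⟩
  have := hμ.isProbabilityMeasure
  have := hν.isProbabilityMeasure
  obtain ⟨γ, hγ, hmono⟩ := exists_isMonotonePlan μ ν
  have hopt := hmono.mem_optimalPlans hγ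
  refine (iInf₂_le γ hopt).trans (EReal.coe_le_coe_iff.2 ?_)
  have h := hlow ν γ hν hγ hmono
  rw [← W2_sq_of_mem_optimalPlans hμ hν hopt] at h
  have h0 : 0 ≤ W2 μ ν := Real.sqrt_nonneg _
  rw [lt_div_iff₀ (by positivity)] at hδ
  have h1 : l * W2 μ ν ^ 2 ≤ ε * W2 μ ν := by nlinarith
  linarith

end Subgradient

/-! ### Perturbations of the identity -/

section Perturbation

variable {W : ℝ → ℝ} {μ : Measure ℝ} {v : ℝ → ℝ} {M : ℝ}

theorem memLp_of_bounded (hμ : IsP2 μ) (hv : Continuous v) (hM : ∀ x, |v x| ≤ M) :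
    MemLp v 2 μ := by
  have := hμ.isProbabilityMeasure
  exact MemLp.of_bound hv.aestronglyMeasurable M (ae_of_all _ hM)

theorem isP2_map_id_add (hμ : IsP2 μ) (hv : Continuous v) (hM : ∀ x, |v x| ≤ M) :
    IsP2 (μ.map fun x => x + v x) := by
  have := hμ.isProbabilityMeasure
  exact isP2_map (by fun_prop) (MemLp.add hμ.memLp (memLp_of_bounded hμ hv hM))

theorem map_graph_mem_plans (hv : Continuous v) :
    μ.map (fun x => (x, x + v x)) ∈ plans μ (μ.map fun x => x + v x) := by
  have hg : Measurable fun x => (x, x + v x) := by fun_prop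
  refine ⟨?_, ?_⟩
  · rw [Measure.map_map measurable_fst hg]
    exact Measure.map_id
  · rw [Measure.map_map measurable_snd hg]
    rfl

theorem cost_map_graph (hμ : IsP2 μ) (hv : Continuous v) (hM : ∀ x, |v x| ≤ M) :
    cost (μ.map fun x => (x, x + v x)) = ENNReal.ofReal (∫ x, v x ^ 2 ∂μ) := by
  have hg : Measurable fun x => (x, x + v x) := by fun_prop
  have hd := memLp_displacement hμ (isP2_map_id_add hμ hv hM) (map_graph_mem_plans hv)
  rw [cost_eq_ofReal hd, integral_map hg.aemeasurable (by fun_prop)]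
  simp

theorem W2_map_id_add_le (hμ : IsP2 μ) (hv : Continuous v) (hM : ∀ x, |v x| ≤ M) :
    W2 μ (μ.map fun x => x + v x) ≤ M := by
  have := hμ.isProbabilityMeasure
  have hM0 : 0 ≤ M := (abs_nonneg _).trans (hM 0)
  refine Real.sqrt_le_iff.2 ⟨hM0, ?_⟩
  refine ENNReal.toReal_le_of_le_ofReal (sq_nonneg M)
    ((iInf₂_le _ (map_graph_mem_plans hv)).trans ?_)
  rw [cost_map_graph hμ hv hM]
  refine ENNReal.ofReal_le_ofReal ?_
  refine (integral_mono (memLp_of_bounded hμ hv hM).integrable_sq (integrable_const (M ^ 2))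
    fun x => sq_le_sq.2 ((hM x).trans (le_abs_self M))).trans ?_
  simp

/-- A monotone bounded perturbation of the identity is the only optimal transport onto its
image. -/
theorem ae_eq_of_mem_optimalPlans (hμ : IsP2 μ) (hv : Continuous v) (hM : ∀ x, |v x| ≤ M)
    (hlip : ∀ a b, |v a - v b| ≤ 1 / 4 * |a - b|) {γ : Measure (ℝ × ℝ)}
    (hγ : γ ∈ optimalPlans μ (μ.map fun x => x + v x)) : ∀ᵐ p ∂γ, p.2 = p.1 + v p.1 := by
  have := hμ.isProbabilityMeasure
  have := isProbabilityMeasure_of_mem_plans hγ.1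
  set T : ℝ → ℝ := fun x => x + v x with hT
  have hTm : Measurable T := by fun_prop
  have hmono : StrictMono T := fun a b hab => by
    have h := hlip b a
    rw [abs_of_pos (sub_pos.2 hab)] at h
    have := neg_le_of_abs_le h
    simp only [hT]
    linarith
  have hsurj : Function.Surjective T := by
    refine Continuous.surjective (by fun_prop) ?_ ?_
    · refine tendsto_atTop_mono (fun x => ?_) (tendsto_atTop_add_const_right atTop (-M) tendsto_id)
      simpa [hT] using (neg_le_of_abs_le (hM x))
    · refine tendsto_atBot_mono (fun x => ?_) (tendsto_atBot_add_const_right atBot M tendsto_id)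
      simpa [hT] using (le_of_abs_le (hM x))
  set e := hmono.orderIsoOfSurjective T hsurj with he
  have heT : ∀ x, e.symm (T x) = x := fun x => e.symm_apply_apply x
  have hTe : ∀ y, e.symm y + v (e.symm y) = y := fun y => e.apply_symm_apply y
  have hem : Measurable e.symm := e.symm.monotone.measurable
  set B : ℝ × ℝ → ℝ := fun p => e.symm p.2 with hB
  have hBm : Measurable B := hem.comp measurable_snd
  have hBmap : γ.map B = μ := by
    have h1 : γ.map B = (γ.map Prod.snd).map e.symm := (Measure.map_map hem measurable_snd).symm
    rw [h1, hγ.1.2, Measure.map_map hem hTm]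
    have h2 : e.symm ∘ T = id := funext heT
    rw [h2, Measure.map_id]
  -- `V` acts as a Kantorovich potential. As `B` and the first coordinate both have law `μ`, the
  -- integrals of `V p.1` and `V (B p)` cancel.
  set V : ℝ → ℝ := fun x => ∫ s in (0 : ℝ)..x, v s with hV
  have hVc : Continuous V := intervalIntegral.continuous_primitive
    (fun a b => hv.intervalIntegrable a b) 0
  have hVtan : ∀ x b, v b * (x - b) - 1 / 4 * (x - b) ^ 2 ≤ V x - V b := by
    intro x b
    have h1 : V x - V b - v b * (x - b) = ∫ s in b..x, (v s - v b) := by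
      rw [intervalIntegral.integral_sub (hv.intervalIntegrable _ _) (by simp),
        intervalIntegral.integral_const, smul_eq_mul, mul_comm (x - b),
        intervalIntegral.integral_interval_sub_left (hv.intervalIntegrable _ _)
          (hv.intervalIntegrable _ _)]
    have h2 : ‖∫ s in b..x, (v s - v b)‖ ≤ 1 / 4 * |x - b| * |x - b| := by
      refine intervalIntegral.norm_integral_le_of_norm_le_const fun s hs => ?_
      refine (hlip s b).trans (mul_le_mul_of_nonneg_left ?_ (by norm_num))
      exact abs_sub_left_of_mem_uIcc (uIoc_subset_uIcc hs)
    rw [← h1, Real.norm_eq_abs, mul_assoc, abs_mul_abs_self] at h2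
    linarith [neg_le_of_abs_le h2]
  have hVi : Integrable V μ := by
    have hb : Integrable (fun x : ℝ => M * |x|) μ :=
      (hμ.memLp.abs.integrable (by norm_num)).const_mul M
    refine hb.mono' hVc.aestronglyMeasurable (ae_of_all _ fun x => ?_)
    have h := intervalIntegral.norm_integral_le_of_norm_le_const (a := 0) (b := x) (f := v)
      (C := M) fun s _ => hM s
    simpa using h
  have hv2 : Integrable (fun x => v x ^ 2) μ := (memLp_of_bounded hμ hv hM).integrable_sq
  have push : ∀ {X : ℝ × ℝ → ℝ} {g : ℝ → ℝ}, Measurable X → γ.map X = μ → Continuous g →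
      Integrable g μ → Integrable (fun p => g (X p)) γ ∧ ∫ p, g (X p) ∂γ = ∫ x, g x ∂μ := by
    intro X g hX hXmap hg hgi
    rw [← hXmap] at hgi ⊢
    exact ⟨(integrable_map_measure hg.aestronglyMeasurable hX.aemeasurable).1 hgi,
      (integral_map hX.aemeasurable hg.aestronglyMeasurable).symm⟩
  obtain ⟨i1, e1⟩ := push measurable_fst hγ.1.1 hVc hVi
  obtain ⟨i2, e2⟩ := push hBm hBmap hVc hVi
  obtain ⟨i3, e3⟩ := push (g := fun x => v x ^ 2) hBm hBmap (by fun_prop) hv2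
  have hd := memLp_displacement hμ (isP2_map_id_add hμ hv hM) hγ.1
  have hcost : ∫ p, (p.2 - p.1) ^ 2 ∂γ ≤ ∫ x, v x ^ 2 ∂μ := by
    have h := hγ.2 _ (map_graph_mem_plans hv)
    rw [cost_map_graph hμ hv hM, cost_eq_ofReal hd] at h
    exact (ENNReal.ofReal_le_ofReal_iff (integral_nonneg fun x => sq_nonneg _)).1 h
  -- Expanding the square around `B p` gives `1/2 (p.1 - B p)²`, of which the tangent bound for `V`
  -- consumes at most `1/4`. After integration the right side is nonpositive by optimality, which
  -- forces `p.1 = B p`.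
  have hpt : ∀ p : ℝ × ℝ, 1 / 4 * (p.1 - B p) ^ 2 ≤
      1 / 2 * (p.2 - p.1) ^ 2 + V p.1 - V (B p) - 1 / 2 * v (B p) ^ 2 := by
    intro p
    have h1 := hVtan p.1 (B p)
    have h2 : p.2 = B p + v (B p) := (hTe p.2).symm
    rw [h2]
    nlinarith
  have hBi : Integrable (fun p => 1 / 4 * (p.1 - B p) ^ 2) γ :=
    ((hμ.memLp_of_map measurable_fst hγ.1.1).sub
      (hμ.memLp_of_map hBm hBmap)).integrable_sq.const_mul _
  have j1 : Integrable (fun p : ℝ × ℝ => 1 / 2 * (p.2 - p.1) ^ 2) γ :=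
    hd.integrable_sq.const_mul _
  have j3 : Integrable (fun p => 1 / 2 * v (B p) ^ 2) γ := i3.const_mul _
  have hle := integral_mono hBi (((j1.add i1).sub i2).sub j3) hpt
  have hzero : ∫ p, 1 / 4 * (p.1 - B p) ^ 2 ∂γ = 0 := by
    refine le_antisymm (hle.trans ?_) (integral_nonneg fun p => by positivity)
    rw [integral_sub' ((j1.add i1).sub i2) j3, integral_sub' (j1.add i1) i2, integral_add' j1 i1,
      e1, e2, integral_const_mul, integral_const_mul, e3]
    linarith
  rw [integral_eq_zero_iff_of_nonneg (fun p => by positivity) hBi] at hzero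
  filter_upwards [hzero] with p hp
  have h1 : p.1 = B p := by
    simp only [Pi.zero_apply, mul_eq_zero, pow_eq_zero_iff two_ne_zero, sub_eq_zero] at hp
    exact hp.resolve_left (by norm_num)
  rw [h1]
  exact (hTe p.2).symm

/-- Differentiation under the integral: off the diagonal, which is null, the integrand is
differentiable at `t = 0`, and for `|t| < 1` the Lipschitz bound on `W` supplies an integrable
Lipschitz constant in `t`. -/
theorem IsAdmissible.hasDerivAt_energy (hW : IsAdmissible W) (hμ : IsP2 μ)
    (hdiff : ∀ x : ℝ, μ {x} = 0) (hv : Continuous v) (hM : ∀ x, |v x| ≤ M) :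
    HasDerivAt (fun t : ℝ => energy W (μ.map fun x => x + t * v x))
      (∫ x, field W μ x * v x ∂μ) 0 := by
  have := hμ.isProbabilityMeasure
  obtain ⟨A, hA, hlip⟩ := hW.exists_lipschitz_bound
  have hM0 : 0 ≤ M := (abs_nonneg _).trans (hM 0)
  have hsub := memLp_sub_prod hμ.memLp
  have hvsub : ∀ z : ℝ × ℝ, |v z.1 - v z.2| ≤ 2 * M := fun z =>
    (abs_sub _ _).trans (by linarith [hM z.1, hM z.2])
  have key := hasDerivAt_integral_of_dominated_loc_of_lip (μ := μ.prod μ) (x₀ := (0 : ℝ))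
    (s := Metric.ball 0 1)
    (F := fun t z => W (z.1 + t * v z.1 - (z.2 + t * v z.2)))
    (F' := fun z => deriv W (z.1 - z.2) * (v z.1 - v z.2))
    (bound := fun z => A * (1 + 2 * (|z.1 - z.2| + 2 * M)) * (2 * M))
    (Metric.ball_mem_nhds _ one_pos)
    (Eventually.of_forall fun t =>
      (hW.continuous.comp (by fun_prop)).aestronglyMeasurable)
    (by simpa using hW.integrable_comp hsub)
    (((measurable_deriv W).comp (by fun_prop)).mul (by fun_prop)).aestronglyMeasurable
    (ae_of_all _ fun z => ?_) ?_ ?_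
  · have h := key.2.const_mul (1 / 2)
    have hF := hW.integral_deriv_mul_sub hμ hdiff measurable_id Measure.map_id
      (memLp_of_bounded hμ hv hM)
    simp only [id_eq] at hF
    rw [hF] at h
    convert! h using 1
    · funext t
      exact energy_map hW (by fun_prop)
    · simp
  · refine LipschitzOnWith.of_dist_le_mul fun t ht s hs => ?_
    have harg : ∀ r ∈ Metric.ball (0 : ℝ) 1,
        |z.1 + r * v z.1 - (z.2 + r * v z.2)| ≤ |z.1 - z.2| + 2 * M := by
      intro r hr
      rw [mem_ball_zero_iff, Real.norm_eq_abs] at hr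
      rw [show z.1 + r * v z.1 - (z.2 + r * v z.2) = (z.1 - z.2) + r * (v z.1 - v z.2) by ring]
      refine (abs_add_le _ _).trans (add_le_add le_rfl ?_)
      rw [abs_mul]
      nlinarith [hvsub z, abs_nonneg (v z.1 - v z.2), abs_nonneg r]
    rw [dist_comm, Real.dist_eq, dist_comm, Real.dist_eq, Real.coe_nnabs]
    refine (hlip _ _).trans ?_
    have hdiff' : z.1 + s * v z.1 - (z.2 + s * v z.2) - (z.1 + t * v z.1 - (z.2 + t * v z.2)) =
        (v z.1 - v z.2) * (s - t) := by ring
    have h1 := harg t ht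
    have h2 := harg s hs
    have h3 := hvsub z
    rw [hdiff', abs_mul, ← mul_assoc]
    refine mul_le_mul_of_nonneg_right ?_ (abs_nonneg _)
    refine le_trans ?_ (le_abs_self _)
    refine mul_le_mul (mul_le_mul_of_nonneg_left (by linarith) hA) h3 (abs_nonneg _)
      (by positivity)
  · have habs : Integrable (fun z : ℝ × ℝ => |z.1 - z.2|) (μ.prod μ) :=
      hsub.abs.integrable (by norm_num)
    exact (((integrable_const _).add ((habs.add (integrable_const _)).const_mul 2)).const_mul
      A).mul_const _
  · filter_upwards [ae_prod_ne (P := μ) measurable_id Measure.map_id hdiff] with z hz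
    have hz' : z.1 + 0 * v z.1 - (z.2 + 0 * v z.2) = z.1 - z.2 := by ring
    have hd : HasDerivAt W (deriv W (z.1 - z.2)) (z.1 + 0 * v z.1 - (z.2 + 0 * v z.2)) := by
      rw [hz']
      exact (hW.differentiableAt (sub_ne_zero.2 hz)).hasDerivAt
    have hin : HasDerivAt (fun t : ℝ => z.1 + t * v z.1 - (z.2 + t * v z.2))
        (v z.1 - v z.2) 0 := by
      have h1 := ((hasDerivAt_id (0 : ℝ)).mul_const (v z.1)).const_add z.1
      have h2 := ((hasDerivAt_id (0 : ℝ)).mul_const (v z.2)).const_add z.2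
      convert! h1.sub h2 using 1
      simp
    exact hd.comp 0 hin

/-- Positive `t` gives `c ≤ d` and negative `t` gives `d ≤ c`; the proof tests `t = ± r / 2`. -/
theorem eq_of_hasDerivAt_of_eventually_le {E : ℝ → ℝ} {c d : ℝ} (hE : HasDerivAt E d 0)
    (h : ∀ ε > 0, ∀ᶠ t in 𝓝 0, t * c ≤ E t - E 0 + ε * |t|) : c = d := by
  rw [hasDerivAt_iff_isLittleO] at hE
  refine eq_of_abs_sub_le_all fun ε hε => ?_
  have h1 := h (ε / 2) (by positivity)
  have h2 := hE.bound (by positivity : 0 < ε / 2)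
  obtain ⟨r, hr, hball⟩ := Metric.eventually_nhds_iff.1 (h1.and h2)
  have hr2 : |r / 2| = r / 2 := abs_of_pos (by positivity)
  obtain ⟨p1, p2⟩ := hball (y := r / 2) (by rw [Real.dist_eq, sub_zero, hr2]; linarith)
  obtain ⟨n1, n2⟩ := hball (y := -(r / 2)) (by rw [Real.dist_eq, sub_zero, abs_neg, hr2]; linarith)
  simp only [sub_zero, Real.norm_eq_abs, smul_eq_mul, abs_neg, hr2] at p1 p2 n1 n2
  have p3 := le_of_abs_le p2
  have n3 := le_of_abs_le n2
  rw [abs_le]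
  constructor <;> nlinarith

/-- On a diffuse measure the subdifferential of the energy contains nothing but the field. -/
theorem IsAdmissible.ae_eq_field_of_mem_subdifferential (hW : IsAdmissible W) (hμ : IsP2 μ)
    (hdiff : ∀ x : ℝ, μ {x} = 0) {ξ : ℝ → ℝ} (hξ : ξ ∈ subdifferential (energy W) μ) :
    ξ =ᵐ[μ] field W μ := by
  have := hμ.isProbabilityMeasure
  have hk := hW.memLp_field hμ hdiff
  refine ae_eq_of_integral_contDiff_smul_eq (hξ.1.locallyIntegrable (by norm_num))
    (hk.locallyIntegrable (by norm_num)) fun v hv hvc => ?_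
  obtain ⟨M, hM⟩ := hvc.exists_bound_of_continuous hv.continuous
  obtain ⟨K, hK⟩ := hv.lipschitzWith_of_hasCompactSupport hvc (by simp)
  have hM0 : 0 ≤ M := (norm_nonneg _).trans (hM 0)
  simp only [smul_eq_mul, mul_comm (v _)]
  refine eq_of_hasDerivAt_of_eventually_le (hW.hasDerivAt_energy hμ hdiff hv.continuous hM)
    fun ε hε => ?_
  obtain ⟨δ, hδ, hsub⟩ := hξ.2 (ε / (M + 1)) (by positivity)
  have hsmall1 : ∀ᶠ t : ℝ in 𝓝 0, |t| * M < δ := by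
    have hc : Tendsto (fun t : ℝ => |t| * M) (𝓝 0) (𝓝 0) := by
      have : Continuous fun t : ℝ => |t| * M := by fun_prop
      simpa using this.tendsto 0
    exact hc.eventually (gt_mem_nhds hδ)
  -- This makes `t * v` satisfy the Lipschitz condition under which the optimal plan is unique.
  have hsmall2 : ∀ᶠ t : ℝ in 𝓝 0, |t| * K < 1 / 4 := by
    have hc : Tendsto (fun t : ℝ => |t| * (K : ℝ)) (𝓝 0) (𝓝 0) := by
      have : Continuous fun t : ℝ => |t| * (K : ℝ) := by fun_prop
      simpa using this.tendsto 0
    exact hc.eventually (gt_mem_nhds (by norm_num))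
  filter_upwards [hsmall1, hsmall2] with t ht1 ht2
  have htv : Continuous fun x => t * v x := hv.continuous.const_mul t
  have htM : ∀ x, |t * v x| ≤ |t| * M := fun x => by
    rw [abs_mul]
    exact mul_le_mul_of_nonneg_left (hM x) (abs_nonneg t)
  have htlip : ∀ a b, |t * v a - t * v b| ≤ 1 / 4 * |a - b| := fun a b => by
    have h := hK.dist_le_mul a b
    rw [Real.dist_eq, Real.dist_eq] at h
    rw [← mul_sub, abs_mul]
    have h1 := mul_le_mul_of_nonneg_left h (abs_nonneg t)
    have h2 := mul_le_mul_of_nonneg_right ht2.le (abs_nonneg (a - b))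
    linarith
  have hW2 := W2_map_id_add_le hμ htv htM
  have h := hsub _ (isP2_map_id_add hμ htv htM) (hW2.trans_lt ht1)
  -- Every optimal plan is carried by the graph of `id + t v`, so all of them give the same value.
  have hinf : ((t * ∫ x, ξ x * v x ∂μ : ℝ) : EReal) ≤
      ⨅ γ ∈ optimalPlans μ (μ.map fun x => x + t * v x),
        ((∫ p, ξ p.1 * (p.2 - p.1) ∂γ : ℝ) : EReal) := by
    refine le_iInf₂ fun γ hγ => EReal.coe_le_coe_iff.2 (le_of_eq ?_)
    have hae := ae_eq_of_mem_optimalPlans hμ htv htM htlip hγ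
    have hmap := hγ.1.1
    have hm : AEStronglyMeasurable (fun x => ξ x * v x) (γ.map Prod.fst) := by
      rw [hmap]
      exact hξ.1.1.mul hv.continuous.aestronglyMeasurable
    rw [← hmap, integral_map measurable_fst.aemeasurable hm, ← integral_const_mul]
    refine integral_congr_ae ?_
    filter_upwards [hae] with p hp
    rw [hp]
    ring
  have hreal := EReal.coe_le_coe_iff.1 (hinf.trans h)
  have hεM : ε / (M + 1) * W2 μ (μ.map fun x => x + t * v x) ≤ ε * |t| := by
    rw [div_mul_eq_mul_div, div_le_iff₀ (by positivity), mul_assoc]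
    refine mul_le_mul_of_nonneg_left (hW2.trans ?_) hε.le
    nlinarith [abs_nonneg t]
  have h0 : (μ.map fun x => x + 0 * v x) = μ := by simp
  rw [h0]
  linarith

end Perturbation

end InteractionEnergy

/-- For `W` satisfying **A**, **B**, **C'** and a diffuse `μ ∈ 𝒫₂(ℝ)`: the energy and the field `k`
are given by convergent integrals, `k ∈ ∂𝒲[μ]`, and `k` is the unique element of `∂𝒲[μ]` of
minimal `L²(μ)`-norm. -/
theorem mainTheorem2 (W : ℝ → ℝ) (hW : InteractionEnergy.IsAdmissible W)
    (μ : MeasureTheory.Measure ℝ) (hμ : InteractionEnergy.IsP2 μ)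
    (hdiff : ∀ x : ℝ, μ {x} = 0) :
    (∀ ν : MeasureTheory.Measure ℝ, InteractionEnergy.IsP2 ν →
      MeasureTheory.Integrable (fun p : ℝ × ℝ => W (p.1 - p.2)) (ν.prod ν)) ∧
    (∀ x : ℝ, MeasureTheory.IntegrableOn (fun y => deriv W (x - y)) {x}ᶜ μ) ∧
    InteractionEnergy.field W μ ∈
      InteractionEnergy.subdifferential (InteractionEnergy.energy W) μ ∧
    ∀ ξ ∈ InteractionEnergy.subdifferential (InteractionEnergy.energy W) μ,
      MeasureTheory.eLpNorm (InteractionEnergy.field W μ) 2 μ ≤ MeasureTheory.eLpNorm ξ 2 μ ∧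
      (MeasureTheory.eLpNorm ξ 2 μ = MeasureTheory.eLpNorm (InteractionEnergy.field W μ) 2 μ →
        ξ =ᵐ[μ] InteractionEnergy.field W μ) := by
  refine ⟨fun ν hν => ?_, fun x => (hW.integrable_deriv_sub hμ x).integrableOn,
    hW.field_mem_subdifferential hμ hdiff, fun ξ hξ => ?_⟩
  · have := hν.isProbabilityMeasure
    exact hW.integrable_comp (InteractionEnergy.memLp_sub_prod hν.memLp)
  · have h := hW.ae_eq_field_of_mem_subdifferential hμ hdiff hξ
    exact ⟨(MeasureTheory.eLpNorm_congr_ae h).ge, fun _ => h⟩
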